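/- Let $H$ be a complex Hilbert space and let $A$ be a JC-algebra on $H$, i.e. a norm-closed real linear space of self-adjoint bounded operators on $H$ that is closed under the Jordan product $a\circ b=\tfrac12(ab+ba)$. Put $U_ab=2a\circ(a\circ b)-(a\circ a)\circ b\ (=aba)$, let $A_+$ be the set of positive operators in $A$, and let $P(A)$ be the set of projections in $A$, ordered as operators. Assume that $A$ is an AJW-algebra, i.e. every set of pairwise orthogonal projections in $P(A)$ has a least upper bound in $P(A)$, and every maximal associative Jordan subalgebra $A_0$ of $A$ is the least norm-closed Jordan subalgebra containing $A_0\cap P(A)$. Assume also that $A$ is reversible: $a_1a_2\cdots a_n+a_n\cdots a_2a_1\in A$ for all $n\ge 1$ and $a_1,\dots,a_n\in A$. For a set $S$ of bounded operators let $R^*(S)$ and $C^*(S)$ be the norm-closed real $*$-algebra and the C$^*$-algebra generated by $S$ (no unit being adjoined), and for a set $S$ of self-adjoint operators let ${}^\perp(S)_+=\{x\in A_+ : U_ax=0 \text{ for all } a\in S\}$. Then $A$ has a unit $1$, the set $I=R^*(A)\cap iR^*(A)$ is a norm-closed two-sided ideal of $C^*(A)$ whose self-adjoint part $I_{sa}$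 is contained in $A$, and there are central projections $e,f$ of $A$ with $e+f=1$ such that $$eA_+={}^\perp\big({}^\perp(I_{sa})_+\big)_+\qquad\text{and}\qquad R^*(fA)\cap iR^*(fA)=\{0\}.$$ -/

import Mathlib

namespace JordanOp

variable {H : Type*} [NormedAddCommGroup H] [InnerProductSpace ℂ H] [CompleteSpace H]

/-- The Jordan product `a ∘ b = (ab + ba) / 2` of operators. -/
noncomputable def jmul (a b : H →L[ℂ] H) : H →L[ℂ] H := (1 / 2 : ℝ) • (a * b + b * a)

/-- The quadratic operator `U_a b = 2 a ∘ (a ∘ b) - (a ∘ a) ∘ b`. -/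
noncomputable def jU (a b : H →L[ℂ] H) : H →L[ℂ] H :=
  (2 : ℝ) • jmul a (jmul a b) - jmul (jmul a a) b

/-- A real linear space of operators that is closed under the Jordan product. -/
def IsJordanSubalgebra (A : Submodule ℝ (H →L[ℂ] H)) : Prop :=
  ∀ a ∈ A, ∀ b ∈ A, jmul a b ∈ A

/-- A JC-algebra on `H`: a norm-closed real Jordan algebra of self-adjoint bounded operators.
It need not contain the identity operator of `H`. -/
structure IsJCAlgebra (A : Submodule ℝ (H →L[ℂ] H)) : Prop where
  isSelfAdjoint : ∀ a ∈ A, IsSelfAdjoint a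
  jordan : IsJordanSubalgebra A
  isClosed : IsClosed (A : Set (H →L[ℂ] H))

/-- The set `P(A)` of projections of `A`; it is ordered by the usual order of operators. -/
def projections (A : Submodule ℝ (H →L[ℂ] H)) : Set (H →L[ℂ] H) :=
  {p | p ∈ A ∧ IsStarProjection p}

/-- `B` is an associative subalgebra of the Jordan algebra `A`. -/
def IsAssocSubalgebra (A B : Submodule ℝ (H →L[ℂ] H)) : Prop :=
  B ≤ A ∧ IsJordanSubalgebra B ∧
    ∀ a ∈ B, ∀ b ∈ B, ∀ c ∈ B, jmul (jmul a b) c = jmul a (jmul b c)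

/-- The least norm-closed Jordan subalgebra containing the set `S`. -/
noncomputable def closedJordanAdjoin (S : Set (H →L[ℂ] H)) : Submodule ℝ (H →L[ℂ] H) :=
  sInf {B | IsJordanSubalgebra B ∧ IsClosed (B : Set (H →L[ℂ] H)) ∧ S ⊆ B}

/-- An AJW-algebra on `H`: a JC-algebra in which every set of pairwise orthogonal projections has
a least upper bound in the poset of projections, and every maximal associative subalgebra is
generated, as a norm-closed subalgebra, by its projections. -/
structure IsAJWAlgebra (A : Submodule ℝ (H →L[ℂ] H)) : Prop extends IsJCAlgebra A where
  exists_isLUB : ∀ S : Set (projections A),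
    S.Pairwise (fun p q => (p : H →L[ℂ] H) * (q : H →L[ℂ] H) = 0) → ∃ p, IsLUB S p
  maximal_assoc : ∀ B : Submodule ℝ (H →L[ℂ] H), Maximal (IsAssocSubalgebra A) B →
    B = closedJordanAdjoin ((B : Set (H →L[ℂ] H)) ∩ projections A)

/-- `A` is reversible: `a₁a₂⋯aₙ + aₙ⋯a₂a₁ ∈ A` for all `a₁, …, aₙ ∈ A`, `n ≥ 1`. -/
def IsReversible (A : Submodule ℝ (H →L[ℂ] H)) : Prop :=
  ∀ l : List (H →L[ℂ] H), l ≠ [] → (∀ a ∈ l, a ∈ A) → l.prod + l.reverse.prod ∈ A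

/-- `R*(S)`: the norm-closed real `*`-algebra generated by `S`. -/
noncomputable def realStarAlg (S : Set (H →L[ℂ] H)) : NonUnitalStarSubalgebra ℝ (H →L[ℂ] H) :=
  (NonUnitalStarAlgebra.adjoin ℝ S).topologicalClosure

/-- `C*(S)`: the C*-algebra generated by `S`. -/
noncomputable def cStarAlg (S : Set (H →L[ℂ] H)) : NonUnitalStarSubalgebra ℂ (H →L[ℂ] H) :=
  (NonUnitalStarAlgebra.adjoin ℂ S).topologicalClosure

/-- `R*(S) ∩ iR*(S)`. -/
def realInterI (S : Set (H →L[ℂ] H)) : Set (H →L[ℂ] H) :=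
  (realStarAlg S : Set (H →L[ℂ] H)) ∩
    (fun x : H →L[ℂ] H => Complex.I • x) '' (realStarAlg S : Set (H →L[ℂ] H))

/-- `I` is a norm-closed two-sided ideal of the C*-algebra `C`. -/
structure IsClosedTwoSidedIdeal (C : NonUnitalStarSubalgebra ℂ (H →L[ℂ] H))
    (I : Submodule ℂ (H →L[ℂ] H)) : Prop where
  subset : ∀ x ∈ I, x ∈ C
  mul_left : ∀ c ∈ C, ∀ x ∈ I, c * x ∈ I
  mul_right : ∀ c ∈ C, ∀ x ∈ I, x * c ∈ I
  isClosed : IsClosed (I : Set (H →L[ℂ] H))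

/-- The self-adjoint part of a set of operators. -/
def saPart (S : Set (H →L[ℂ] H)) : Set (H →L[ℂ] H) := {x | x ∈ S ∧ IsSelfAdjoint x}

/-- The positive cone `A₊`. -/
def posCone (A : Submodule ℝ (H →L[ℂ] H)) : Set (H →L[ℂ] H) := {x | x ∈ A ∧ 0 ≤ x}

/-- `⊥(S)₊`: the positive `x ∈ A` with `U_a x = 0` for all `a ∈ S`. -/
def perpPos (A : Submodule ℝ (H →L[ℂ] H)) (S : Set (H →L[ℂ] H)) : Set (H →L[ℂ] H) :=
  {x | x ∈ posCone A ∧ ∀ a ∈ S, jU a x = 0}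

/-- `e` is a central projection of `A`. -/
def IsCentralProjection (A : Submodule ℝ (H →L[ℂ] H)) (e : H →L[ℂ] H) : Prop :=
  e ∈ projections A ∧ ∀ a ∈ A, Commute e a

/-- `u` is the unit element of the Jordan algebra `A`. -/
def IsJordanUnit (A : Submodule ℝ (H →L[ℂ] H)) (u : H →L[ℂ] H) : Prop :=
  u ∈ A ∧ ∀ a ∈ A, jmul u a = a

end JordanOp

/-!
Write `I = R*(A) ∩ iR*(A)`. Reversibility says that `x + x^*` lies in `A` for every `x` in `R*(A)`,
so `J = I_sa` is a Jordan ideal of `A`. The projection `e` is the support of `J`: the least upper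
bound of a maximal orthogonal family of projections in `J`.

The main point is that every `b ≠ 0` in `J` divides a nonzero projection `q = by` in `J`. A maximal
associative subalgebra containing `b` is commutative, hence densely spanned by its projections, and
cutting by these one at a time produces a projection `r` for which `br` is almost a nonzero multiple
of `r`. Maximality of the family then makes `e` a unit for `J`, and minimality of the upper bound
shows that a positive element annihilating `J` annihilates `e`. Applied to `w^* w` with
`w = (1 - e)ae`, which annihilates `J`, this gives that `e` is central.

The unit of `A` is the support of `A` itself. With `f = 1 - e`, the elements of
`R*(fA) ∩ iR*(fA) ⊆ I` are fixed by `e`, which is a unit for `I`, and killed by it, as `fe = 0`.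
-/

namespace JordanOp

theorem exists_maximal_pairwise_subset {α : Type*} {r : α → α → Prop} {Q S : Set α} (hS : S ⊆ Q)
    (hr : S.Pairwise r) :
    ∃ T, S ⊆ T ∧ T ⊆ Q ∧ T.Pairwise r ∧ ∀ a ∈ Q, (∀ b ∈ T, r a b ∧ r b a) → a ∈ T := by
  obtain ⟨T, hST, hT⟩ := zorn_subset_nonempty {T : Set α | T ⊆ Q ∧ T.Pairwise r}
    (fun c hc hchain _ => ⟨⋃₀ c, ⟨Set.sUnion_subset fun s hs => (hc hs).1,
      (Set.pairwise_sUnion hchain.directedOn).2 fun s hs => (hc hs).2⟩,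
      fun _ => Set.subset_sUnion_of_mem⟩) S ⟨hS, hr⟩
  refine ⟨T, hST, hT.prop.1, hT.prop.2, fun a ha haT => ?_⟩
  exact hT.le_of_ge ⟨Set.insert_subset ha hT.prop.1, hT.prop.2.insert fun b hb _ => haT b hb⟩
    (Set.subset_insert a T) (Set.mem_insert a T)

theorem lie_lie_mul_self {R : Type*} [Ring R] (a c : R) :
    ⁅a, ⁅a, c * c⁆⁆ = c * ⁅a, ⁅a, c⁆⁆ + 2 • (⁅a, c⁆ * ⁅a, c⁆) + ⁅a, ⁅a, c⁆⁆ * c := by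
  simp only [Ring.lie_def]
  noncomm_ring

-- For the derivation `δ = ⁅a, ·⁆`, `δ²c = 0` and `δ²(c²) = 0` force `(δc)² = 0`, and `δc` is skew.
theorem commute_of_lie_lie_eq_zero {R : Type*} [NormedRing R] [StarRing R] [CStarRing R]
    [IsAddTorsionFree R] {a c : R} (ha : IsSelfAdjoint a) (hc : IsSelfAdjoint c)
    (h : ⁅a, ⁅a, c⁆⁆ = 0) (h' : ⁅a, ⁅a, c * c⁆⁆ = 0) : Commute a c := by
  have hsq : ⁅a, c⁆ * ⁅a, c⁆ = 0 := by
    rwa [lie_lie_mul_self, h, mul_zero, zero_mul, zero_add, add_zero,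
      nsmul_eq_zero_iff_right two_ne_zero] at h'
  have hstar : star ⁅a, c⁆ = -⁅a, c⁆ := by
    rw [Ring.lie_def, star_sub, star_mul, star_mul, ha.star_eq, hc.star_eq, neg_sub]
  rw [commute_iff_lie_eq, ← CStarRing.star_mul_self_eq_zero_iff, hstar, neg_mul, hsq, neg_zero]

theorem mul_eq_zero_of_star_mul_mul_eq_zero {R : Type*} [CStarAlgebra R] [PartialOrder R]
    [StarOrderedRing R] {x a : R} (hx : 0 ≤ x) (h : star a * x * a = 0) : x * a = 0 := by
  obtain ⟨s, rfl⟩ := CStarAlgebra.nonneg_iff_eq_star_mul_self.1 hx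
  have hsa : s * a = 0 := by
    rw [← CStarRing.star_mul_self_eq_zero_iff, star_mul, ← h]
    simp only [mul_assoc]
  rw [mul_assoc, hsa, mul_zero]

theorem norm_mul_eq_or_norm_mul_one_sub_eq {R : Type*} [CStarAlgebra R] {c p : R}
    (hp : IsStarProjection p) (hcp : Commute c p) : ‖c * p‖ = ‖c‖ ∨ ‖c * (1 - p)‖ = ‖c‖ := by
  have hadd : star (c * p) * (c * p) + star (c * (1 - p)) * (c * (1 - p)) = star c * c := by
    rw [hcp.eq, (((Commute.one_right c).sub_right hcp)).eq, star_mul, star_mul,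
      hp.isSelfAdjoint.star_eq, hp.one_sub.isSelfAdjoint.star_eq, mul_assoc, mul_assoc,
      ← mul_assoc p, ← mul_assoc (1 - p), hp.isIdempotentElem.eq,
      hp.one_sub.isIdempotentElem.eq, ← mul_add, ← add_mul, add_sub_cancel, one_mul]
  have hmul : star (c * p) * (c * p) * (star (c * (1 - p)) * (c * (1 - p))) = 0 := by
    rw [star_mul c (1 - p), hp.one_sub.isSelfAdjoint.star_eq, mul_assoc, mul_assoc c,
      mul_assoc (1 - p), ← mul_assoc p, hp.mul_one_sub_self, zero_mul, mul_zero, mul_zero]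
  have hmax := IsSelfAdjoint.norm_add_eq_max (.star_mul_self _) (.star_mul_self _) hmul
  simp only [hadd, CStarRing.norm_star_mul_self] at hmax
  rcases max_choice (‖c * p‖ * ‖c * p‖) (‖c * (1 - p)‖ * ‖c * (1 - p)‖) with h | h
  · exact .inl ((mul_self_inj (norm_nonneg _) (norm_nonneg _)).1 (hmax.trans h).symm)
  · exact .inr ((mul_self_inj (norm_nonneg _) (norm_nonneg _)).1 (hmax.trans h).symm)

theorem commute_of_mem_subringClosure {R : Type*} [Ring R] {s : Set R} {a r : R}
    (ha : ∀ p ∈ s, Commute a p) (hr : r ∈ Subring.closure s) : Commute a r := by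
  have hs : s ⊆ Subring.centralizer {a} := fun p hp =>
    Subring.mem_centralizer_iff.2 fun _ h => h ▸ ha p hp
  exact Subring.mem_centralizer_iff.1 (Subring.closure_le.2 hs hr) a rfl

theorem exists_isStarProjection_norm_mul_eq {R : Type*} [CStarAlgebra R] {s : Set R}
    (hs : s.Finite) (hproj : ∀ p ∈ s, IsStarProjection p)
    (hcomm : ∀ p ∈ s, ∀ q ∈ s, Commute p q) {b : R} (hb : ∀ p ∈ s, Commute b p) :
    ∃ r ∈ Subring.closure s, IsStarProjection r ∧ ‖b * r‖ = ‖b‖ ∧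
      ∀ p ∈ s, p * r = 0 ∨ p * r = r := by
  induction s, hs using Set.Finite.induction_on with
  | empty => exact ⟨1, one_mem _, .one R, by rw [mul_one], by simp⟩
  | @insert p s _ _ ih =>
    simp only [Set.forall_mem_insert] at hproj hcomm hb ⊢
    obtain ⟨r, hrs, hr, hbr, hsr⟩ := ih hproj.2 (fun q hq => (hcomm.2 q hq).2) hb.2
    have hpr : Commute p r := commute_of_mem_subringClosure hcomm.1.2 hrs
    have hbrp : Commute (b * r) p := hb.1.mul_left hpr.symm
    have hp_mem : p ∈ Subring.closure (insert p s) := Subring.subset_closure (Set.mem_insert p s)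
    have hr_mem : r ∈ Subring.closure (insert p s) :=
      Subring.closure_mono (Set.subset_insert p s) hrs
    have hsrz (z : R) : ∀ q ∈ s, q * (r * z) = 0 ∨ q * (r * z) = r * z := fun q hq => by
      rw [← mul_assoc]
      exact (hsr q hq).imp (fun h => by rw [h, zero_mul]) (fun h => by rw [h])
    rcases norm_mul_eq_or_norm_mul_one_sub_eq hproj.1 hbrp with hnorm | hnorm
    · refine ⟨r * p, mul_mem hr_mem hp_mem, hr.mul hproj.1 hpr.symm, ?_, .inr ?_, hsrz p⟩
      · rw [← mul_assoc, hnorm, hbr]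
      · rw [← mul_assoc, hpr.eq, mul_assoc, hproj.1.isIdempotentElem.eq]
    · refine ⟨r * (1 - p), mul_mem hr_mem (sub_mem (one_mem _) hp_mem),
        hr.mul hproj.1.one_sub ((Commute.one_right r).sub_right hpr.symm), ?_, .inl ?_,
        hsrz (1 - p)⟩
      · rw [← mul_assoc, hnorm, hbr]
      · rw [← mul_assoc, hpr.eq, mul_assoc, hproj.1.mul_one_sub_self, mul_zero]

theorem exists_mul_eq_of_norm_sub_lt_one {R : Type*} [NormedRing R] [CompleteSpace R]
    {B : NonUnitalSubring R} (hB : IsClosed (B : Set R)) {q x : R} (hq : q ∈ B)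
    (hqq : IsIdempotentElem q) (hx : x ∈ B) (hqx : q * x = x) (hxq : x * q = x)
    (hlt : ‖q - x‖ < 1) : ∃ y ∈ B, x * y = q := by
  have hmem (n : ℕ) : q * (q - x) ^ n ∈ B := by
    induction n with
    | zero => simpa using hq
    | succ n ih => rw [pow_succ, ← mul_assoc]; exact mul_mem ih (sub_mem hq hx)
  have hgeom : Summable fun n : ℕ => (q - x) ^ n := summable_geometric_of_norm_lt_one hlt
  have hfactor : x = q * (1 - (q - x)) := by
    rw [mul_sub, mul_sub, mul_one, hqq.eq, hqx, sub_sub_cancel]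
  refine ⟨∑' n, q * (q - x) ^ n, tsum_mem hB hmem, ?_⟩
  calc x * ∑' n, q * (q - x) ^ n = x * ∑' n, (q - x) ^ n := by
        rw [hgeom.tsum_mul_left, ← mul_assoc, hxq]
    _ = q * ((1 - (q - x)) * ∑' n, (q - x) ^ n) := by rw [← mul_assoc, ← hfactor]
    _ = q := by rw [mul_neg_geom_series _ hlt, mul_one]

theorem mul_mem_of_mem_subringClosure {R : Type*} [Ring R] {B : NonUnitalSubring R} {x r : R}
    (hx : x ∈ B) (hr : r ∈ Subring.closure (B : Set R)) : x * r ∈ B := by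
  induction hr using Subring.closure_induction generalizing x with
  | mem a ha => exact mul_mem hx ha
  | zero => rw [mul_zero]; exact zero_mem B
  | one => rwa [mul_one]
  | add a b _ _ iha ihb => rw [mul_add]; exact add_mem (iha hx) (ihb hx)
  | neg a _ ih => rw [mul_neg]; exact neg_mem (ih hx)
  | mul a b _ _ iha ihb => rw [← mul_assoc]; exact ihb (iha hx)

theorem exists_mul_eq_smul_of_mem_span {𝕜 R : Type*} [Field 𝕜] [Ring R] [Algebra 𝕜 R] {s : Set R}
    {r d : R} (hr : ∀ p ∈ s, p * r = 0 ∨ p * r = r) (hd : d ∈ Submodule.span 𝕜 s) :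
    ∃ t : 𝕜, d * r = t • r := by
  induction hd using Submodule.span_induction with
  | mem p hp =>
    rcases hr p hp with h | h
    · exact ⟨0, by rw [h, zero_smul]⟩
    · exact ⟨1, by rw [h, one_smul]⟩
  | zero => exact ⟨0, by rw [zero_mul, zero_smul]⟩
  | add x y _ _ ihx ihy =>
    obtain ⟨t, ht⟩ := ihx
    obtain ⟨u, hu⟩ := ihy
    exact ⟨t + u, by rw [add_mul, ht, hu, add_smul]⟩
  | smul c x _ ih =>
    obtain ⟨t, ht⟩ := ih
    exact ⟨c * t, by rw [smul_mul_assoc, ht, smul_smul]⟩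

section ProjectionsDense

variable {𝕜 R : Type*} [NormedField 𝕜] [CStarAlgebra R] [NormedAlgebra 𝕜 R]
  {B : NonUnitalSubalgebra 𝕜 R} {b : R}

theorem exists_isStarProjection_norm_sub_smul_mul_lt_one
    (hcomm : ∀ x ∈ B, ∀ y ∈ B, Commute x y)
    (hspan : (B : Set R) ⊆ closure (Submodule.span 𝕜 {p | p ∈ B ∧ IsStarProjection p}))
    (hb : b ∈ B) (hb0 : b ≠ 0) :
    ∃ r ∈ B, IsStarProjection r ∧ r ≠ 0 ∧ ∃ t : 𝕜, ‖r - t • (b * r)‖ < 1 := by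
  obtain ⟨d, hd, hbd⟩ := Metric.mem_closure_iff.1 (hspan hb) (‖b‖ / 2)
    (half_pos (norm_pos_iff.2 hb0))
  obtain ⟨s, hsP, hds⟩ := Submodule.mem_span_finite_of_mem_span hd
  obtain ⟨r, hrs, hr, hbr, hsr⟩ := exists_isStarProjection_norm_mul_eq s.finite_toSet
    (fun p hp => (hsP hp).2) (fun p hp q hq => hcomm p (hsP hp).1 q (hsP hq).1)
    (fun p hp => hcomm b hb p (hsP hp).1)
  have hr0 : r ≠ 0 := by
    rintro rfl
    rw [mul_zero, norm_zero, eq_comm, norm_eq_zero] at hbr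
    exact hb0 hbr
  have hdrB : d * r ∈ B :=
    mul_mem_of_mem_subringClosure (B := B.toNonUnitalSubring)
      ((Submodule.span_le (p := B.toSubmodule)).2 (fun p hp => hp.1) hd)
      (Subring.closure_mono (fun p hp => (hsP hp).1) hrs)
  obtain ⟨t, hdr⟩ := exists_mul_eq_smul_of_mem_span hsr hds
  have hdist : ‖(d - b) * r‖ < ‖b‖ / 2 := by
    rw [dist_comm, dist_eq_norm] at hbd
    exact (norm_mul_le_of_le le_rfl hr.norm_le).trans_lt (by rwa [mul_one])
  have hnorm_t : ‖(d - b) * r‖ < ‖t‖ := by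
    have htri : ‖b * r‖ ≤ ‖t • r‖ + ‖(d - b) * r‖ := by
      rw [← hdr, ← sub_sub_cancel (d * r) (b * r), ← sub_mul]
      exact norm_sub_le _ _
    have htr : ‖t • r‖ ≤ ‖t‖ := by
      rw [norm_smul]
      exact mul_le_of_le_one_right (norm_nonneg t) hr.norm_le
    linarith
  have ht : t ≠ 0 := norm_pos_iff.1 ((norm_nonneg _).trans_lt hnorm_t)
  have hrd : t⁻¹ • (d * r) = r := by rw [hdr, inv_smul_smul₀ ht]
  refine ⟨r, hrd ▸ SMulMemClass.smul_mem t⁻¹ hdrB, hr, hr0, t⁻¹, ?_⟩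
  nth_rw 1 [← hrd]
  rwa [← smul_sub, ← sub_mul, norm_smul, norm_inv, inv_mul_lt_one₀ (norm_pos_iff.2 ht)]

theorem exists_isStarProjection_mul_eq (hB : IsClosed (B : Set R))
    (hcomm : ∀ x ∈ B, ∀ y ∈ B, Commute x y)
    (hspan : (B : Set R) ⊆ closure (Submodule.span 𝕜 {p | p ∈ B ∧ IsStarProjection p}))
    (hb : b ∈ B) (hb0 : b ≠ 0) :
    ∃ q ∈ B, IsStarProjection q ∧ q ≠ 0 ∧ ∃ y ∈ B, b * y = q := by
  obtain ⟨r, hrB, hr, hr0, t, hlt⟩ :=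
    exists_isStarProjection_norm_sub_smul_mul_lt_one hcomm hspan hb hb0
  have hxB : t • (b * r) ∈ B := SMulMemClass.smul_mem t (mul_mem hb hrB)
  have hxr : t • (b * r) * r = t • (b * r) := by
    rw [smul_mul_assoc, mul_assoc, hr.isIdempotentElem.eq]
  obtain ⟨y, hy, hxy⟩ := exists_mul_eq_of_norm_sub_lt_one (B := B.toNonUnitalSubring) hB hrB
    hr.isIdempotentElem hxB ((hcomm r hrB _ hxB).eq.trans hxr) hxr hlt
  refine ⟨r, hrB, hr, hr0, t • (r * y), SMulMemClass.smul_mem t (mul_mem hrB hy), ?_⟩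
  rw [mul_smul_comm, ← mul_assoc, ← smul_mul_assoc, hxy]

end ProjectionsDense

section Jordan

variable {H : Type*} [NormedAddCommGroup H] [InnerProductSpace ℂ H]

theorem jmul_comm (a b : H →L[ℂ] H) : jmul a b = jmul b a := by
  rw [jmul, jmul, add_comm]

theorem jmul_eq_mul_of_commute {a b : H →L[ℂ] H} (h : Commute a b) : jmul a b = a * b := by
  rw [jmul, ← h.eq, ← two_smul ℝ (a * b), smul_smul]
  norm_num

theorem jmul_self (a : H →L[ℂ] H) : jmul a a = a * a :=
  jmul_eq_mul_of_commute (Commute.refl a)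

theorem two_smul_jmul (a b : H →L[ℂ] H) : (2 : ℝ) • jmul a b = a * b + b * a := by
  rw [jmul, smul_smul]
  norm_num

theorem jU_eq_mul_mul (a b : H →L[ℂ] H) : jU a b = a * b * a := by
  rw [jU, jmul_self]
  simp only [jmul, mul_add, add_mul, mul_smul_comm, smul_mul_assoc, smul_add, smul_smul, mul_assoc]
  module

theorem jmul_jmul_self_sub_jmul_jmul (a c : H →L[ℂ] H) :
    jmul (jmul a a) c - jmul a (jmul a c) = (1 / 4 : ℝ) • ⁅a, ⁅a, c⁆⁆ := by
  rw [jmul_self]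
  simp only [jmul, Ring.lie_def, mul_add, add_mul, mul_sub, sub_mul, mul_smul_comm, smul_mul_assoc,
    smul_add, smul_sub, smul_smul, mul_assoc]
  module

theorem closedJordanAdjoin_subset_closure_span (P : Subsemigroup (H →L[ℂ] H)) :
    (closedJordanAdjoin (P : Set (H →L[ℂ] H)) : Set (H →L[ℂ] H)) ⊆
      closure (Submodule.span ℝ (P : Set (H →L[ℂ] H))) := by
  let C := (NonUnitalAlgebra.adjoin ℝ (P : Set (H →L[ℂ] H))).topologicalClosure
  have hC : IsJordanSubalgebra C.toSubmodule := fun a ha b hb =>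
    C.smul_mem' _ (add_mem (s := C) (mul_mem (s := C) ha hb) (mul_mem (s := C) hb ha))
  have hPC : (P : Set (H →L[ℂ] H)) ⊆ C :=
    (NonUnitalAlgebra.subset_adjoin ℝ).trans subset_closure
  have hle : closedJordanAdjoin (P : Set (H →L[ℂ] H)) ≤ C.toSubmodule :=
    sInf_le ⟨hC, isClosed_closure, hPC⟩
  have hspan : ((NonUnitalAlgebra.adjoin ℝ (P : Set (H →L[ℂ] H))).toSubmodule : Set (H →L[ℂ] H)) =
      Submodule.span ℝ (P : Set (H →L[ℂ] H)) := by
    rw [NonUnitalAlgebra.adjoin_eq_span, Subsemigroup.closure_eq]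
  rw [← hspan]
  exact hle

/-- `J` is a Jordan ideal of `A`: a real subspace of `A` which absorbs Jordan products with elements
of `A`. No closedness is required. -/
structure IsJordanIdeal (A J : Submodule ℝ (H →L[ℂ] H)) : Prop where
  le : J ≤ A
  jmul_mem : ∀ a ∈ A, ∀ x ∈ J, jmul a x ∈ J

namespace IsJordanIdeal

variable {A J : Submodule ℝ (H →L[ℂ] H)} {a x : H →L[ℂ] H}

protected theorem refl (hA : IsJordanSubalgebra A) : IsJordanIdeal A A := ⟨le_rfl, hA⟩

theorem mul_add_mul_mem (hJ : IsJordanIdeal A J) (ha : a ∈ A) (hx : x ∈ J) :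
    a * x + x * a ∈ J :=
  two_smul_jmul a x ▸ J.smul_mem 2 (hJ.jmul_mem a ha x hx)

theorem mul_self_mem (hJ : IsJordanIdeal A J) (hx : x ∈ J) : x * x ∈ J :=
  jmul_self x ▸ hJ.jmul_mem x (hJ.le hx) x hx

theorem conj_mem (hA : IsJordanSubalgebra A) (hJ : IsJordanIdeal A J) (ha : a ∈ A) (hx : x ∈ J) :
    a * x * a ∈ J :=
  jU_eq_mul_mul a x ▸ J.sub_mem
    (J.smul_mem 2 (hJ.jmul_mem a ha _ (hJ.jmul_mem a ha x hx)))
    (hJ.jmul_mem _ (hA a ha a ha) x hx)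

theorem conj_mem_of_mem (hJ : IsJordanIdeal A J) (hx : x ∈ J) (ha : a ∈ A) : x * a * x ∈ J := by
  have hxa : jmul x a ∈ J := jmul_comm a x ▸ hJ.jmul_mem a ha x hx
  rw [← jU_eq_mul_mul, jU, jmul_self, jmul_comm (x * x) a]
  exact J.sub_mem (J.smul_mem 2 (hJ.jmul_mem x (hJ.le hx) _ hxa))
    (hJ.jmul_mem a ha _ (hJ.mul_self_mem hx))

theorem one_sub_conj_mem (hA : IsJordanSubalgebra A) (hJ : IsJordanIdeal A J) (ha : a ∈ A)
    (hx : x ∈ J) : (1 - a) * x * (1 - a) ∈ J := by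
  have h : (1 - a) * x * (1 - a) = x - (a * x + x * a) + a * x * a := by
    simp only [sub_mul, mul_sub, one_mul, mul_one]
    abel
  rw [h]
  exact J.add_mem (J.sub_mem hx (hJ.mul_add_mul_mem ha hx)) (hJ.conj_mem hA ha hx)

end IsJordanIdeal

end Jordan

variable {H : Type*} [NormedAddCommGroup H] [InnerProductSpace ℂ H] [CompleteSpace H]
  {A J : Submodule ℝ (H →L[ℂ] H)}

theorem IsJCAlgebra.commute_of_isAssocSubalgebra (hA : IsJCAlgebra A)
    {B : Submodule ℝ (H →L[ℂ] H)} (hB : IsAssocSubalgebra A B) {a c : H →L[ℂ] H} (ha : a ∈ B)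
    (hc : c ∈ B) : Commute a c := by
  obtain ⟨hBA, hBj, hassoc⟩ := hB
  have : IsAddTorsionFree (H →L[ℂ] H) := .of_isTorsionFree ℝ _
  have hlie (x : H →L[ℂ] H) (hx : x ∈ B) : ⁅a, ⁅a, x⁆⁆ = 0 := by
    have h := jmul_jmul_self_sub_jmul_jmul a x
    rw [hassoc a ha a ha x hx, sub_self] at h
    exact (smul_eq_zero.1 h.symm).resolve_left (by norm_num)
  exact commute_of_lie_lie_eq_zero (hA.isSelfAdjoint a (hBA ha)) (hA.isSelfAdjoint c (hBA hc))
    (hlie c hc) (hlie (c * c) (jmul_self c ▸ hBj c hc c hc))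

theorem IsJCAlgebra.exists_maximal_commutative (hA : IsJCAlgebra A) {b : H →L[ℂ] H} (hb : b ∈ A) :
    ∃ B : NonUnitalSubalgebra ℝ (H →L[ℂ] H), b ∈ B ∧ B.toSubmodule ≤ A ∧
      (∀ x ∈ B, ∀ y ∈ B, Commute x y) ∧ ∀ x ∈ A, (∀ y ∈ B, Commute x y) → x ∈ B := by
  obtain ⟨T, hbT, hTA, hT, hmax⟩ := exists_maximal_pairwise_subset (r := Commute)
    (Set.singleton_subset_iff.2 hb) (Set.pairwise_singleton b _)
  have hcomm : ∀ x ∈ T, ∀ y ∈ T, Commute x y := fun x hx y hy => by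
    rcases eq_or_ne x y with rfl | hxy
    · exact Commute.refl x
    · exact hT hx hy hxy
  have hmem {x : H →L[ℂ] H} (hx : x ∈ A) (hxT : ∀ y ∈ T, Commute x y) : x ∈ T :=
    hmax x hx fun y hy => ⟨hxT y hy, (hxT y hy).symm⟩
  have hmul {x y : H →L[ℂ] H} (hx : x ∈ T) (hy : y ∈ T) : x * y ∈ T :=
    hmem (jmul_eq_mul_of_commute (hcomm x hx y hy) ▸ hA.jordan x (hTA hx) y (hTA hy))
      fun z hz => (hcomm x hx z hz).mul_left (hcomm y hy z hz)
  let B : NonUnitalSubalgebra ℝ (H →L[ℂ] H) :=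
    { carrier := T
      zero_mem' := hmem A.zero_mem fun y _ => Commute.zero_left y
      add_mem' := fun {x y} hx hy => hmem (A.add_mem (hTA hx) (hTA hy))
        fun z hz => (hcomm x hx z hz).add_left (hcomm y hy z hz)
      mul_mem' := hmul
      smul_mem' := fun r x hx => hmem (A.smul_mem r (hTA hx))
        fun z hz => (hcomm x hx z hz).smul_left r }
  exact ⟨B, hbT rfl, hTA, hcomm, fun x => hmem⟩

theorem IsJCAlgebra.maximal_isAssocSubalgebra (hA : IsJCAlgebra A)
    {B : NonUnitalSubalgebra ℝ (H →L[ℂ] H)} (hBA : B.toSubmodule ≤ A)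
    (hcomm : ∀ x ∈ B, ∀ y ∈ B, Commute x y) (hmax : ∀ x ∈ A, (∀ y ∈ B, Commute x y) → x ∈ B) :
    Maximal (IsAssocSubalgebra A) B.toSubmodule := by
  refine ⟨⟨hBA, fun x hx y hy => ?_, fun x hx y hy z hz => ?_⟩, fun C hC hBC c hc => ?_⟩
  · rw [jmul_eq_mul_of_commute (hcomm x hx y hy)]
    exact mul_mem (s := B) hx hy
  · rw [jmul_eq_mul_of_commute (hcomm x hx y hy), jmul_eq_mul_of_commute (hcomm y hy z hz),
      jmul_eq_mul_of_commute (hcomm _ (mul_mem (s := B) hx hy) z hz),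
      jmul_eq_mul_of_commute (hcomm x hx _ (mul_mem (s := B) hy hz)), mul_assoc]
  · exact hmax c (hC.1 hc) fun y hy => hA.commute_of_isAssocSubalgebra hC hc (hBC hy)

theorem IsAJWAlgebra.exists_commutative (hA : IsAJWAlgebra A) {b : H →L[ℂ] H} (hb : b ∈ A) :
    ∃ B : NonUnitalSubalgebra ℝ (H →L[ℂ] H), b ∈ B ∧ B.toSubmodule ≤ A ∧
      IsClosed (B : Set (H →L[ℂ] H)) ∧ (∀ x ∈ B, ∀ y ∈ B, Commute x y) ∧
      (B : Set (H →L[ℂ] H)) ⊆ closure (Submodule.span ℝ {p | p ∈ B ∧ IsStarProjection p}) := by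
  obtain ⟨B, hbB, hBA, hcomm, hmax⟩ := hA.exists_maximal_commutative hb
  let P : Subsemigroup (H →L[ℂ] H) :=
    { carrier := {p | p ∈ B ∧ IsStarProjection p}
      mul_mem' := fun {p q} hp hq => ⟨mul_mem hp.1 hq.1, hp.2.mul hq.2 (hcomm p hp.1 q hq.1)⟩ }
  have hclosed : IsClosed (B : Set (H →L[ℂ] H)) := by
    have hB : (B : Set (H →L[ℂ] H)) = (A : Set (H →L[ℂ] H)) ∩ Set.centralizer B :=
      Set.Subset.antisymm (fun x hx => ⟨hBA hx, fun y hy => (hcomm y hy x hx).eq⟩)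
        (fun x hx => hmax x hx.1 fun y hy => (hx.2 y hy).symm)
    rw [hB]
    exact hA.isClosed.inter (Set.isClosed_centralizer _)
  have hP : (B : Set (H →L[ℂ] H)) ∩ projections A = P :=
    Set.ext fun p => ⟨fun hp => ⟨hp.1, hp.2.2⟩, fun hp => ⟨hp.1, hBA hp.1, hp.2⟩⟩
  have hgen := hA.maximal_assoc _ (hA.maximal_isAssocSubalgebra hBA hcomm hmax)
  refine ⟨B, hbB, hBA, hclosed, hcomm, fun x hx => closedJordanAdjoin_subset_closure_span P ?_⟩
  rw [← hP]
  exact hgen ▸ hx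

theorem IsAJWAlgebra.exists_projection (hA : IsAJWAlgebra A) (hJ : IsJordanIdeal A J)
    {b : H →L[ℂ] H} (hb : b ∈ J) (hb0 : b ≠ 0) :
    ∃ q ∈ projections A, q ∈ J ∧ q ≠ 0 ∧ ∃ y, b * y = q := by
  obtain ⟨B, hbB, hBA, hclosed, hcomm, hspan⟩ := hA.exists_commutative (hJ.le hb)
  obtain ⟨q, hqB, hq, hq0, y, hy, hyq⟩ :=
    exists_isStarProjection_mul_eq hclosed hcomm hspan hbB hb0
  have hqJ : b * (y * y) * b = q := by
    rw [← mul_assoc, mul_assoc, ← (hcomm b hbB y hy).eq, hyq, hq.isIdempotentElem.eq]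
  exact ⟨q, ⟨hBA hqB, hq⟩, hqJ ▸ hJ.conj_mem_of_mem hb (hBA (mul_mem (s := B) hy hy)), hq0, y, hyq⟩

theorem IsAJWAlgebra.exists_isLUB_projections (hA : IsAJWAlgebra A)
    (J : Submodule ℝ (H →L[ℂ] H)) :
    ∃ (T : Set (projections A)) (e : projections A), IsLUB T e ∧
      (∀ p ∈ T, (p : H →L[ℂ] H) ∈ J) ∧
      ∀ q ∈ projections A, q ∈ J → (e : H →L[ℂ] H) * q = 0 → q = 0 := by
  obtain ⟨T, -, hTJ, hT, hmax⟩ := exists_maximal_pairwise_subset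
    (r := fun p q : projections A => (p : H →L[ℂ] H) * (q : H →L[ℂ] H) = 0)
    (Set.empty_subset {p : projections A | (p : H →L[ℂ] H) ∈ J}) (Set.pairwise_empty _)
  obtain ⟨e, he⟩ := hA.exists_isLUB T hT
  refine ⟨T, e, he, hTJ, fun q hq hqJ heq => ?_⟩
  have hTe (p : projections A) (hp : p ∈ T) : (p : H →L[ℂ] H) * e = p :=
    (p.2.2.le_iff_mul_eq_left e.2.2).1 (he.1 hp)
  have hTq (p : projections A) (hp : p ∈ T) : (p : H →L[ℂ] H) * q = 0 := by
    rw [← hTe p hp, mul_assoc, heq, mul_zero]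
  have hqT : ⟨q, hq⟩ ∈ T := hmax ⟨q, hq⟩ hqJ fun p hp =>
    ⟨(p.2.2.isSelfAdjoint.commute_of_mul_eq_zero hq.2.isSelfAdjoint (hTq p hp)).eq ▸ hTq p hp,
      hTq p hp⟩
  exact hq.2.isIdempotentElem.eq.symm.trans (hTq _ hqT)

theorem IsAJWAlgebra.mul_eq_zero_of_isLUB (hA : IsAJWAlgebra A) {T : Set (projections A)}
    {e : projections A} (he : IsLUB T e) {x : H →L[ℂ] H} (hx : x ∈ posCone A)
    (hxT : ∀ p ∈ T, x * p = 0) : x * e = 0 := by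
  refine mul_eq_zero_of_star_mul_mul_eq_zero hx.2 ?_
  rw [e.2.2.isSelfAdjoint.star_eq]
  have hrefl := IsJordanIdeal.refl hA.jordan
  by_contra hb
  obtain ⟨q, hq, -, hq0, y, hy⟩ :=
    hA.exists_projection hrefl (hrefl.conj_mem hA.jordan e.2.1 hx.1) hb
  have hTe (p : projections A) (hp : p ∈ T) : (p : H →L[ℂ] H) * e = p :=
    (p.2.2.le_iff_mul_eq_left e.2.2).1 (he.1 hp)
  have hTq (p : projections A) (hp : p ∈ T) : (p : H →L[ℂ] H) * q = 0 := by
    have hxp := (hA.isSelfAdjoint x hx.1).commute_of_mul_eq_zero p.2.2.isSelfAdjoint (hxT p hp)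
    have hpx : (p : H →L[ℂ] H) * x = 0 := hxp.eq ▸ hxT p hp
    rw [← hy, ← mul_assoc, ← mul_assoc, ← mul_assoc, hTe p hp, hpx, zero_mul, zero_mul]
  have heq : (e : H →L[ℂ] H) * q = q := by
    rw [← hy, ← mul_assoc, ← mul_assoc, ← mul_assoc, e.2.2.isIdempotentElem.eq]
  -- `e - q` is an upper bound of `T` as well, so it dominates `e`.
  let r : projections A := ⟨e - q, A.sub_mem e.2.1 hq.1, hq.2.sub_of_mul_eq_right e.2.2 heq⟩
  have hr : r ∈ upperBounds T := fun p hp => (p.2.2.le_iff_mul_eq_left r.2.2).2 <| by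
    rw [mul_sub, hTe p hp, hTq p hp, sub_zero]
  have her : (e : H →L[ℂ] H) * (e - q) = e := (e.2.2.le_iff_mul_eq_left r.2.2).1 (he.2 hr)
  rw [mul_sub, e.2.2.isIdempotentElem.eq, heq, sub_eq_self] at her
  exact hq0 her

theorem IsAJWAlgebra.mul_eq_of_mem_jordanIdeal (hA : IsAJWAlgebra A) (hJ : IsJordanIdeal A J)
    {e : H →L[ℂ] H} (he : e ∈ projections A)
    (hmax : ∀ q ∈ projections A, q ∈ J → e * q = 0 → q = 0) {x : H →L[ℂ] H} (hx : x ∈ J) :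
    x * e = x := by
  have hxsa := hA.isSelfAdjoint x (hJ.le hx)
  have hb : (1 - e) * (x * x) * (1 - e) = 0 := by
    by_contra hb
    obtain ⟨q, hq, hqJ, hq0, y, hy⟩ :=
      hA.exists_projection hJ (hJ.one_sub_conj_mem hA.jordan he.1 (hJ.mul_self_mem hx)) hb
    refine hq0 (hmax q hq hqJ ?_)
    rw [← hy, ← mul_assoc, ← mul_assoc, ← mul_assoc, he.2.mul_one_sub_self, zero_mul, zero_mul,
      zero_mul]
  have hxe : x * (1 - e) = 0 := by
    rw [← CStarRing.star_mul_self_eq_zero_iff, star_mul, he.2.one_sub.isSelfAdjoint.star_eq,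
      hxsa.star_eq, ← hb]
    simp only [mul_assoc]
  rwa [mul_sub, mul_one, sub_eq_zero, eq_comm] at hxe

/-- The projection `e` of `A` is the support of `J`: it is a unit for `J`, and a positive element of
`A` that annihilates `J` annihilates `e`. -/
structure IsSupport (A J : Submodule ℝ (H →L[ℂ] H)) (e : H →L[ℂ] H) : Prop where
  mem_projections : e ∈ projections A
  mul_eq : ∀ x ∈ J, x * e = x
  mul_eq_zero : ∀ x ∈ posCone A, (∀ y ∈ J, x * y = 0) → x * e = 0

theorem IsAJWAlgebra.exists_isSupport (hA : IsAJWAlgebra A) (hJ : IsJordanIdeal A J) :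
    ∃ e, IsSupport A J e := by
  obtain ⟨T, e, he, hTJ, hmax⟩ := hA.exists_isLUB_projections J
  exact ⟨e, e.2, fun x hx => hA.mul_eq_of_mem_jordanIdeal hJ e.2 hmax hx,
    fun x hx hxJ => hA.mul_eq_zero_of_isLUB he hx fun p hp => hxJ p (hTJ p hp)⟩

theorem IsSupport.mul_eq_left {e x : H →L[ℂ] H} (he : IsSupport A J e) (hA : IsJCAlgebra A)
    (hJ : IsJordanIdeal A J) (hx : x ∈ J) : e * x = x := by
  have hxsa := hA.isSelfAdjoint x (hJ.le hx)
  have h := congrArg star (he.mul_eq x hx)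
  rwa [star_mul, he.mem_projections.2.isSelfAdjoint.star_eq, hxsa.star_eq] at h

theorem IsSupport.isCentralProjection {e : H →L[ℂ] H} (he : IsSupport A J e) (hA : IsJCAlgebra A)
    (hJ : IsJordanIdeal A J) : IsCentralProjection A e := by
  refine ⟨he.mem_projections, fun a ha => ?_⟩
  obtain ⟨heA, hep⟩ := he.mem_projections
  have hasa := hA.isSelfAdjoint a ha
  have hrefl := IsJordanIdeal.refl hA.jordan
  have hay (y : H →L[ℂ] H) (hy : y ∈ J) : e * (a * y) = a * y := by
    have h := he.mul_eq_left hA hJ (hJ.mul_add_mul_mem ha hy)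
    rwa [mul_add, ← mul_assoc e y, he.mul_eq_left hA hJ hy, add_left_inj] at h
  set w := (1 - e) * a * e with hw
  have hwA : star w * w ∈ A := by
    have h : star w * w = e * (a * a - a * e * a) * e := by
      have h1 : (1 - e) * ((1 - e) * a * e) = (1 - e) * a * e := by
        rw [← mul_assoc, ← mul_assoc, hep.one_sub.isIdempotentElem.eq]
      rw [hw, star_mul, star_mul, hasa.star_eq, hep.isSelfAdjoint.star_eq,
        hep.one_sub.isSelfAdjoint.star_eq, mul_assoc, mul_assoc, h1]
      simp only [sub_mul, mul_sub, one_mul, mul_assoc]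
    exact h ▸ hrefl.conj_mem hA.jordan heA
      (A.sub_mem (hrefl.mul_self_mem ha) (hrefl.conj_mem hA.jordan ha heA))
  have hwJ (y : H →L[ℂ] H) (hy : y ∈ J) : star w * w * y = 0 := by
    have hwy : w * y = 0 := by
      rw [hw, mul_assoc, he.mul_eq_left hA hJ hy, mul_assoc, sub_mul, one_mul, hay y hy, sub_self]
    rw [mul_assoc, hwy, mul_zero]
  have hw0 : w = 0 := by
    rw [← CStarRing.star_mul_self_eq_zero_iff,
      ← he.mul_eq_zero _ ⟨hwA, star_mul_self_nonneg w⟩ hwJ, mul_assoc, hw, mul_assoc _ e,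
      hep.isIdempotentElem.eq]
  have hae : e * a * e = a * e := by
    rwa [hw, sub_mul, sub_mul, one_mul, sub_eq_zero, eq_comm] at hw0
  have hsa : IsSelfAdjoint (e * a * e) := hA.isSelfAdjoint _ (hrefl.conj_mem hA.jordan heA ha)
  exact ((IsSelfAdjoint.commute_iff hasa hep.isSelfAdjoint).2 (hae ▸ hsa)).symm

theorem IsCentralProjection.mul_mul_self {e a : H →L[ℂ] H} (he : IsCentralProjection A e)
    (ha : a ∈ A) : e * a * e = e * a := by
  rw [mul_assoc, ← (he.2 a ha).eq, ← mul_assoc, he.1.2.isIdempotentElem.eq]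

theorem IsCentralProjection.mul_mem {e a : H →L[ℂ] H} (he : IsCentralProjection A e)
    (hA : IsJordanSubalgebra A) (ha : a ∈ A) : e * a ∈ A :=
  he.mul_mul_self ha ▸ (IsJordanIdeal.refl hA).conj_mem hA he.1.1 ha

theorem jU_eq_zero_iff {a x : H →L[ℂ] H} (ha : IsSelfAdjoint a) (hx : 0 ≤ x) :
    jU a x = 0 ↔ x * a = 0 := by
  rw [jU_eq_mul_mul]
  refine ⟨fun h => mul_eq_zero_of_star_mul_mul_eq_zero hx (ha.star_eq.symm ▸ h), fun h => ?_⟩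
  rw [mul_assoc, h, mul_zero]

theorem IsSupport.mem_perpPos_iff {e x : H →L[ℂ] H} (he : IsSupport A J e) (hA : IsJCAlgebra A)
    (hJ : IsJordanIdeal A J) : x ∈ perpPos A J ↔ x ∈ posCone A ∧ x * e = 0 := by
  refine and_congr_right fun hx => ?_
  have hiff (a : H →L[ℂ] H) (ha : a ∈ J) : jU a x = 0 ↔ x * a = 0 :=
    jU_eq_zero_iff (hA.isSelfAdjoint a (hJ.le ha)) hx.2
  refine ⟨fun h => he.mul_eq_zero x hx fun a ha => (hiff a ha).1 (h a ha), fun h a ha => ?_⟩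
  rw [hiff a ha, ← he.mul_eq_left hA hJ ha, ← mul_assoc, h, zero_mul]

theorem IsSupport.isJordanUnit {u : H →L[ℂ] H} (hu : IsSupport A A u) (hA : IsJCAlgebra A) :
    IsJordanUnit A u := by
  have huc := hu.isCentralProjection hA (IsJordanIdeal.refl hA.jordan)
  refine ⟨huc.1.1, fun a ha => ?_⟩
  rw [jmul_comm, jmul_eq_mul_of_commute (huc.2 a ha).symm, hu.mul_eq a ha]

theorem IsSupport.sub_mul_self {e u : H →L[ℂ] H} (he : IsSupport A J e) (hu : IsSupport A A u)
    (hA : IsJCAlgebra A) : (u - e) * e = 0 := by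
  rw [sub_mul, hu.mul_eq_left hA (IsJordanIdeal.refl hA.jordan) he.mem_projections.1,
    he.mem_projections.2.isIdempotentElem.eq, sub_self]

theorem IsSupport.isCentralProjection_sub {e u : H →L[ℂ] H} (he : IsSupport A J e)
    (hu : IsSupport A A u) (hA : IsJCAlgebra A) (hJ : IsJordanIdeal A J) :
    IsCentralProjection A (u - e) := by
  obtain ⟨heA, hep⟩ := he.mem_projections
  obtain ⟨⟨huA, hup⟩, hucomm⟩ := hu.isCentralProjection hA (IsJordanIdeal.refl hA.jordan)
  exact ⟨⟨A.sub_mem huA heA, hep.sub_of_mul_eq_left hup (hu.mul_eq e heA)⟩, fun a ha =>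
    (hucomm a ha).sub_left ((he.isCentralProjection hA hJ).2 a ha)⟩

theorem IsSupport.image_mul_posCone {e u : H →L[ℂ] H} (he : IsSupport A J e)
    (hu : IsSupport A A u) (hA : IsJCAlgebra A) (hJ : IsJordanIdeal A J) :
    (fun a => e * a) '' posCone A = perpPos A (perpPos A J) := by
  have hec := he.isCentralProjection hA hJ
  refine Set.Subset.antisymm ?_ fun x hx => ⟨x, hx.1, ?_⟩
  · rintro _ ⟨a, ha, rfl⟩
    have hpos : 0 ≤ e * a := hec.mul_mul_self ha.1 ▸ hec.1.2.isSelfAdjoint.conjugate_nonneg ha.2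
    refine ⟨⟨hec.mul_mem hA.jordan ha.1, hpos⟩, fun y hy => ?_⟩
    obtain ⟨hyA, hye⟩ := (he.mem_perpPos_iff hA hJ).1 hy
    rw [jU_eq_zero_iff (hA.isSelfAdjoint y hyA.1) hpos]
    rw [(hec.2 a ha.1).eq, mul_assoc, (hec.2 y hyA.1).eq, hye, mul_zero]
  · have hf := (he.isCentralProjection_sub hu hA hJ).1
    have hfperp : u - e ∈ perpPos A J :=
      (he.mem_perpPos_iff hA hJ).2 ⟨⟨hf.1, hf.2.nonneg⟩, he.sub_mul_self hu hA⟩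
    have hxf : x * (u - e) = 0 := (jU_eq_zero_iff hf.2.isSelfAdjoint hx.1.2).1 (hx.2 _ hfperp)
    rwa [mul_sub, hu.mul_eq x hx.1.1, sub_eq_zero, ← (hec.2 x hx.1.1).eq, eq_comm] at hxf

theorem star_list_prod_of_isSelfAdjoint {R : Type*} [Monoid R] [StarMul R] {l : List R}
    (hl : ∀ a ∈ l, IsSelfAdjoint a) : star l.prod = l.reverse.prod :=
  (unop_map_list_prod (starMulEquiv (R := R)) l).trans
    (congrArg (fun m => m.reverse.prod) ((List.map_congr_left hl).trans l.map_id))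

theorem exists_list_of_mem_subsemigroupClosure {M : Type*} [Monoid M] {s : Set M} {x : M}
    (hx : x ∈ Subsemigroup.closure s) : ∃ l : List M, l ≠ [] ∧ (∀ a ∈ l, a ∈ s) ∧ l.prod = x := by
  induction hx using Subsemigroup.closure_induction with
  | mem a ha => exact ⟨[a], List.cons_ne_nil a [], by simpa using ha, List.prod_singleton⟩
  | mul x y _ _ hx hy =>
    obtain ⟨l, hl, hls, rfl⟩ := hx
    obtain ⟨m, -, hms, rfl⟩ := hy
    exact ⟨l ++ m, List.append_ne_nil_of_left_ne_nil hl m,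
      fun a ha => (List.mem_append.1 ha).elim (hls a) (hms a), List.prod_append⟩

theorem IsReversible.add_star_mem_of_mem_adjoin (hrev : IsReversible A)
    (hA : ∀ a ∈ A, IsSelfAdjoint a) {x : H →L[ℂ] H}
    (hx : x ∈ NonUnitalStarAlgebra.adjoin ℝ (A : Set (H →L[ℂ] H))) : x + star x ∈ A := by
  have hstar : star (A : Set (H →L[ℂ] H)) ⊆ A := fun a ha =>
    star_star a ▸ (hA _ ha).star_eq.symm ▸ ha
  replace hx : x ∈ Submodule.span ℝ (Subsemigroup.closure (A : Set (H →L[ℂ] H))) := by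
    rw [← Set.union_eq_self_of_subset_right hstar, ← NonUnitalStarAlgebra.adjoin_eq_span]
    exact hx
  induction hx using Submodule.span_induction with
  | mem w hw =>
    obtain ⟨l, hl, hlA, rfl⟩ := exists_list_of_mem_subsemigroupClosure hw
    rw [star_list_prod_of_isSelfAdjoint fun a ha => hA a (hlA a ha)]
    exact hrev l hl hlA
  | zero => rw [star_zero, add_zero]; exact A.zero_mem
  | add y z _ _ hy hz => rw [star_add, add_add_add_comm]; exact A.add_mem hy hz
  | smul r y _ hy => rw [star_smul, star_trivial, ← smul_add]; exact A.smul_mem r hy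

theorem IsReversible.mem_of_mem_realStarAlg (hrev : IsReversible A) (hA : IsJCAlgebra A)
    {x : H →L[ℂ] H} (hx : x ∈ realStarAlg (A : Set (H →L[ℂ] H))) (hxsa : IsSelfAdjoint x) :
    x ∈ A := by
  have hclosed : IsClosed {y : H →L[ℂ] H | y + star y ∈ A} :=
    hA.isClosed.preimage (continuous_id.add continuous_star)
  have hmem : x + star x ∈ A :=
    closure_minimal (fun y => hrev.add_star_mem_of_mem_adjoin hA.isSelfAdjoint) hclosed hx
  rwa [hxsa.star_eq, ← two_smul ℝ x, A.smul_mem_iff two_ne_zero] at hmem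

theorem subset_realStarAlg (S : Set (H →L[ℂ] H)) : S ⊆ realStarAlg S :=
  (NonUnitalStarAlgebra.subset_adjoin ℝ S).trans subset_closure

theorem subset_cStarAlg (S : Set (H →L[ℂ] H)) : S ⊆ cStarAlg S :=
  (NonUnitalStarAlgebra.subset_adjoin ℂ S).trans subset_closure

theorem realStarAlg_le {S : Set (H →L[ℂ] H)} {B : NonUnitalStarSubalgebra ℝ (H →L[ℂ] H)}
    (hS : S ⊆ B) (hB : IsClosed (B : Set (H →L[ℂ] H))) : realStarAlg S ≤ B :=
  NonUnitalStarSubalgebra.topologicalClosure_minimal _ (NonUnitalStarAlgebra.adjoin_le hS) hB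

theorem realStarAlg_subset_cStarAlg (S : Set (H →L[ℂ] H)) :
    (realStarAlg S : Set (H →L[ℂ] H)) ⊆ cStarAlg S := by
  let C : NonUnitalStarSubalgebra ℝ (H →L[ℂ] H) :=
    { cStarAlg S with
      smul_mem' := fun r x hx => by
        rw [← Complex.coe_smul]
        exact (cStarAlg S).smul_mem' _ hx }
  exact realStarAlg_le (B := C) (subset_cStarAlg S) isClosed_closure

theorem mul_eq_zero_of_mem_realStarAlg {S : Set (H →L[ℂ] H)} {e z : H →L[ℂ] H}
    (hS : ∀ a ∈ S, a * e = 0 ∧ star a * e = 0) (hz : z ∈ realStarAlg S) : z * e = 0 := by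
  let B : NonUnitalStarSubalgebra ℝ (H →L[ℂ] H) :=
    { carrier := {x | x * e = 0 ∧ star x * e = 0}
      zero_mem' := ⟨zero_mul e, by rw [star_zero, zero_mul]⟩
      add_mem' := fun {x y} hx hy =>
        ⟨by rw [add_mul, hx.1, hy.1, add_zero], by rw [star_add, add_mul, hx.2, hy.2, add_zero]⟩
      mul_mem' := fun {x y} hx hy =>
        ⟨by rw [mul_assoc, hy.1, mul_zero], by rw [star_mul, mul_assoc, hx.2, mul_zero]⟩
      smul_mem' := fun r x hx =>
        ⟨by rw [smul_mul_assoc, hx.1, smul_zero],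
          by rw [star_smul, smul_mul_assoc, hx.2, smul_zero]⟩
      star_mem' := fun {x} hx => ⟨hx.2, (star_star x).symm ▸ hx.1⟩ }
  have hB : IsClosed (B : Set (H →L[ℂ] H)) :=
    (isClosed_eq (continuous_mul_const e) continuous_const).inter
      (isClosed_eq ((continuous_mul_const e).comp continuous_star) continuous_const)
  exact (realStarAlg_le (B := B) hS hB hz).1

section Idealizer

variable {𝕜 R : Type*} [CommSemiring 𝕜] [NonUnitalSemiring R] [StarRing R] [Module 𝕜 R]
  [IsScalarTower 𝕜 R R] [SMulCommClass 𝕜 R R]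

/-- The two-sided idealizer of a star-closed subspace `I`: the star subalgebra of those elements
whose left and right multiples of `I` stay in `I`. -/
def idealizer (I : Submodule 𝕜 R) (hI : ∀ x ∈ I, star x ∈ I) : NonUnitalStarSubalgebra 𝕜 R where
  carrier := {c | ∀ x ∈ I, c * x ∈ I ∧ x * c ∈ I}
  zero_mem' := fun x _ => by rw [zero_mul, mul_zero]; exact ⟨I.zero_mem, I.zero_mem⟩
  add_mem' := fun hc hd x hx => by
    rw [add_mul, mul_add]
    exact ⟨I.add_mem (hc x hx).1 (hd x hx).1, I.add_mem (hc x hx).2 (hd x hx).2⟩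
  mul_mem' := fun {c d} hc hd x hx => by
    rw [mul_assoc, ← mul_assoc x]
    exact ⟨(hc _ (hd x hx).1).1, (hd _ (hc x hx).2).2⟩
  smul_mem' := fun r c hc x hx => by
    rw [smul_mul_assoc, mul_smul_comm]
    exact ⟨I.smul_mem r (hc x hx).1, I.smul_mem r (hc x hx).2⟩
  star_mem' := fun {c} hc x hx => by
    have h := hc _ (hI x hx)
    have hl := hI _ h.2
    have hr := hI _ h.1
    rw [star_mul, star_star] at hl hr
    exact ⟨hl, hr⟩

theorem isClosed_idealizer [TopologicalSpace R] [SeparatelyContinuousMul R] {I : Submodule 𝕜 R}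
    (hI : ∀ x ∈ I, star x ∈ I) (hclosed : IsClosed (I : Set R)) :
    IsClosed (idealizer I hI : Set R) := by
  have h : (idealizer I hI : Set R) = ⋂ x ∈ I, {c | c * x ∈ I} ∩ {c | x * c ∈ I} := by
    ext c
    simp only [Set.mem_iInter]
    rfl
  rw [h]
  exact isClosed_biInter fun x _ => (hclosed.preimage (continuous_mul_const x)).inter
    (hclosed.preimage (continuous_const_mul x))

end Idealizer

theorem mem_realInterI {S : Set (H →L[ℂ] H)} {x : H →L[ℂ] H} :
    x ∈ realInterI S ↔ x ∈ realStarAlg S ∧ Complex.I • x ∈ realStarAlg S := by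
  refine and_congr_right fun _ => ⟨?_, fun h => ⟨-(Complex.I • x), neg_mem h, ?_⟩⟩
  · rintro ⟨y, hy, rfl⟩
    rw [smul_smul, Complex.I_mul_I, neg_one_smul]
    exact neg_mem hy
  · change Complex.I • -(Complex.I • x) = x
    rw [smul_neg, smul_smul, Complex.I_mul_I, neg_one_smul, neg_neg]

/-- `R*(S) ∩ iR*(S)` as a complex subspace. -/
def realInterISubmodule (S : Set (H →L[ℂ] H)) : Submodule ℂ (H →L[ℂ] H) where
  carrier := realInterI S
  zero_mem' := mem_realInterI.2 ⟨zero_mem _, by rw [smul_zero]; exact zero_mem _⟩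
  add_mem' := fun {x y} hx hy => by
    rw [mem_realInterI] at *
    exact ⟨add_mem hx.1 hy.1, smul_add Complex.I x y ▸ add_mem hx.2 hy.2⟩
  smul_mem' := fun c x hx => by
    rw [mem_realInterI] at *
    have hc : c • x = c.re • x + c.im • (Complex.I • x) := by
      rw [← Complex.coe_smul c.re x, ← Complex.coe_smul c.im, smul_smul, ← add_smul,
        Complex.re_add_im]
    have hci : Complex.I • c • x = c.re • (Complex.I • x) - c.im • x := by
      rw [hc, smul_add, smul_comm Complex.I c.re, smul_comm Complex.I c.im, smul_smul Complex.I,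
        Complex.I_mul_I, neg_one_smul, smul_neg, sub_eq_add_neg]
    rw [hci, hc]
    exact ⟨add_mem (SMulMemClass.smul_mem _ hx.1) (SMulMemClass.smul_mem _ hx.2),
      sub_mem (SMulMemClass.smul_mem _ hx.2) (SMulMemClass.smul_mem _ hx.1)⟩

theorem mem_realInterISubmodule {S : Set (H →L[ℂ] H)} {x : H →L[ℂ] H} :
    x ∈ realInterISubmodule S ↔ x ∈ realStarAlg S ∧ Complex.I • x ∈ realStarAlg S :=
  mem_realInterI

theorem star_mem_realInterISubmodule {S : Set (H →L[ℂ] H)} {x : H →L[ℂ] H}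
    (hx : x ∈ realInterISubmodule S) : star x ∈ realInterISubmodule S := by
  rw [mem_realInterISubmodule] at *
  have hI : Complex.I • star x = -star (Complex.I • x) := by
    rw [star_smul, ← neg_smul, Complex.star_def, Complex.conj_I, neg_neg]
  exact ⟨star_mem hx.1, hI ▸ neg_mem (star_mem hx.2)⟩

theorem isClosed_realInterISubmodule (S : Set (H →L[ℂ] H)) :
    IsClosed (realInterISubmodule S : Set (H →L[ℂ] H)) := by
  have hR : IsClosed (realStarAlg S : Set (H →L[ℂ] H)) := isClosed_closure
  have h : (realInterISubmodule S : Set (H →L[ℂ] H)) = (realStarAlg S : Set (H →L[ℂ] H)) ∩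
      (fun x : H →L[ℂ] H => Complex.I • x) ⁻¹' (realStarAlg S : Set (H →L[ℂ] H)) :=
    Set.ext fun x => mem_realInterISubmodule
  rw [h]
  exact hR.inter (hR.preimage (continuous_const_smul Complex.I))

theorem isClosedTwoSidedIdeal_realInterISubmodule (S : Set (H →L[ℂ] H)) :
    IsClosedTwoSidedIdeal (cStarAlg S) (realInterISubmodule S) := by
  have hS : S ⊆ idealizer (realInterISubmodule S) fun _ => star_mem_realInterISubmodule := by
    intro a ha x hx
    have haR : a ∈ realStarAlg S := subset_realStarAlg S ha
    rw [mem_realInterISubmodule] at hx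
    rw [mem_realInterISubmodule, mem_realInterISubmodule, ← mul_smul_comm, ← smul_mul_assoc]
    exact ⟨⟨mul_mem haR hx.1, mul_mem haR hx.2⟩, mul_mem hx.1 haR, mul_mem hx.2 haR⟩
  have hC : cStarAlg S ≤ idealizer _ _ :=
    NonUnitalStarSubalgebra.topologicalClosure_minimal _ (NonUnitalStarAlgebra.adjoin_le hS)
      (isClosed_idealizer _ (isClosed_realInterISubmodule S))
  exact ⟨fun x hx => realStarAlg_subset_cStarAlg S (mem_realInterISubmodule.1 hx).1,
    fun c hc x hx => (hC hc x hx).1, fun c hc x hx => (hC hc x hx).2,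
    isClosed_realInterISubmodule S⟩

theorem realInterI_mono {S T : Set (H →L[ℂ] H)} (h : S ⊆ T) : realInterI S ⊆ realInterI T :=
  fun _ hx =>
    have hle : realStarAlg S ≤ realStarAlg T :=
      realStarAlg_le (h.trans (subset_realStarAlg T)) isClosed_closure
    mem_realInterI.2 ((mem_realInterI.1 hx).imp (fun h => hle h) fun h => hle h)

theorem realInterI_eq_singleton_zero {S T : Set (H →L[ℂ] H)} {e : H →L[ℂ] H} (hST : S ⊆ T)
    (hS : ∀ a ∈ S, a * e = 0 ∧ star a * e = 0) (hT : ∀ z ∈ realInterI T, z * e = z) :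
    realInterI S = {0} := by
  refine Set.Subset.antisymm (fun z hz => ?_)
    (Set.singleton_subset_iff.2 (realInterISubmodule S).zero_mem)
  rw [Set.mem_singleton_iff, ← hT z (realInterI_mono hST hz),
    mul_eq_zero_of_mem_realStarAlg hS (mem_realInterI.1 hz).1]

theorem IsCentralProjection.realInterI_mul_image {e f : H →L[ℂ] H} (hf : IsCentralProjection A f)
    (hA : IsJCAlgebra A) (hfe : f * e = 0)
    (he : ∀ z ∈ realInterI (A : Set (H →L[ℂ] H)), z * e = z) :
    realInterI ((fun a => f * a) '' (A : Set (H →L[ℂ] H))) = {0} := by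
  refine realInterI_eq_singleton_zero (T := A) ?_ ?_ he
  · rintro _ ⟨a, ha, rfl⟩
    exact hf.mul_mem hA.jordan ha
  · rintro _ ⟨a, ha, rfl⟩
    have hfae : f * a * e = 0 := by rw [(hf.2 a ha).eq, mul_assoc, hfe, mul_zero]
    exact ⟨hfae, (hA.isSelfAdjoint _ (hf.mul_mem hA.jordan ha)).star_eq.symm ▸ hfae⟩

/-- The self-adjoint part of a complex subspace, as a real subspace. -/
noncomputable def saSubmodule (I : Submodule ℂ (H →L[ℂ] H)) : Submodule ℝ (H →L[ℂ] H) :=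
  I.restrictScalars ℝ ⊓ selfAdjoint.submodule ℝ (H →L[ℂ] H)

theorem coe_saSubmodule (I : Submodule ℂ (H →L[ℂ] H)) :
    (saSubmodule I : Set (H →L[ℂ] H)) = saPart (I : Set (H →L[ℂ] H)) :=
  rfl

theorem IsClosedTwoSidedIdeal.isJordanIdeal_saSubmodule {I : Submodule ℂ (H →L[ℂ] H)}
    (hI : IsClosedTwoSidedIdeal (cStarAlg (A : Set (H →L[ℂ] H))) I) (hA : IsJCAlgebra A)
    (hIA : saPart (I : Set (H →L[ℂ] H)) ⊆ A) : IsJordanIdeal A (saSubmodule I) where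
  le := hIA
  jmul_mem a ha x hx :=
    have haC : a ∈ cStarAlg (A : Set (H →L[ℂ] H)) := subset_cStarAlg _ ha
    ⟨(I.restrictScalars ℝ).smul_mem _ (I.add_mem (hI.mul_left a haC x hx.1)
      (hI.mul_right a haC x hx.1)), hA.isSelfAdjoint _ (hA.jordan a ha x (hIA hx))⟩

theorem IsSupport.mul_eq_of_mem {e z : H →L[ℂ] H} {I : Submodule ℂ (H →L[ℂ] H)}
    {C : NonUnitalStarSubalgebra ℂ (H →L[ℂ] H)} (he : IsSupport A (saSubmodule I) e)
    (hI : IsClosedTwoSidedIdeal C I) (hz : z ∈ I) : z * e = z := by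
  have hzz : star z * z * (1 - e) = 0 := by
    rw [mul_sub, mul_one, sub_eq_zero, he.mul_eq _
      ⟨hI.mul_left _ (star_mem (hI.subset z hz)) z hz, IsSelfAdjoint.star_mul_self z⟩]
  have hze : z * (1 - e) = 0 := by
    rw [← CStarRing.star_mul_self_eq_zero_iff, star_mul, mul_assoc, ← mul_assoc (star z), hzz,
      mul_zero]
  rwa [mul_sub, mul_one, sub_eq_zero, eq_comm] at hze

end JordanOp

open JordanOp in
theorem lemma2p5 {H : Type*} [NormedAddCommGroup H] [InnerProductSpace ℂ H] [CompleteSpace H]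
    (A : Submodule ℝ (H →L[ℂ] H)) (hA : IsAJWAlgebra A) (hrev : IsReversible A) :
    ∃ (e f : H →L[ℂ] H) (I : Submodule ℂ (H →L[ℂ] H)),
      IsCentralProjection A e ∧ IsCentralProjection A f ∧ IsJordanUnit A (e + f) ∧
      (I : Set (H →L[ℂ] H)) = realInterI (A : Set (H →L[ℂ] H)) ∧
      IsClosedTwoSidedIdeal (cStarAlg (A : Set (H →L[ℂ] H))) I ∧
      saPart (I : Set (H →L[ℂ] H)) ⊆ A ∧
      (fun a => e * a) '' posCone A = perpPos A (perpPos A (saPart (I : Set (H →L[ℂ] H)))) ∧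
      realInterI ((fun a => f * a) '' (A : Set (H →L[ℂ] H))) = {0} := by
  have hJC := hA.toIsJCAlgebra
  have hI := isClosedTwoSidedIdeal_realInterISubmodule (A : Set (H →L[ℂ] H))
  set I := realInterISubmodule (A : Set (H →L[ℂ] H))
  have hIA : saPart (I : Set (H →L[ℂ] H)) ⊆ A := fun x hx =>
    hrev.mem_of_mem_realStarAlg hJC (mem_realInterISubmodule.1 hx.1).1 hx.2
  have hJ := hI.isJordanIdeal_saSubmodule hJC hIA
  obtain ⟨e, he⟩ := hA.exists_isSupport hJ
  obtain ⟨u, hu⟩ := hA.exists_isSupport (IsJordanIdeal.refl hJC.jordan)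
  have hec := he.isCentralProjection hJC hJ
  have hfc := he.isCentralProjection_sub hu hJC hJ
  refine ⟨e, u - e, I, hec, hfc, ?_, rfl, hI, hIA, ?_, ?_⟩
  · exact (add_sub_cancel e u).symm ▸ hu.isJordanUnit hJC
  · exact coe_saSubmodule I ▸ he.image_mul_posCone hu hJC hJ
  · exact hfc.realInterI_mul_image hJC (he.sub_mul_self hu hJC) fun z hz => he.mul_eq_of_mem hI hz
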